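/- Let $\mathbb F$ be a finite field and let $k$ be a perfect field containing $\mathbb F$. An $\mathbb F$-vector space scheme over $k$ is a functor $(\mathrm{Sch}/k)^{\circ}\to \mathrm{Vect}_{\mathbb F}$ whose underlying functor to sets is representable by a finite (automatically locally free, of finite presentation) $k$-scheme; morphisms are the natural transformations, i.e. the morphisms of group schemes that commute with the action of $\mathbb F$. Put $\mathbb F^{\vee}=\mathrm{Hom}(\mathbb F^{\times},k^{\times})$. If $G=\mathrm{Spec}\,A$ is an $\mathbb F$-vector space scheme over $k$, multiplication by $\lambda\in\mathbb F$ on $G$ induces $[\lambda]\colon A\to A$, and for $\chi\in\mathbb F^{\vee}$ we set $A_\chi=\{a\in A : [\lambda]a=\chi(\lambda)a \text{ for all }\lambda\in\mathbb F^{\times}\}$. The character of $G$ is $$\mathrm{Ch}_k(G)=\sum_{\chi\in\mathbb F^{\vee}}\dim_k(A_\chi)\,[\chi]\in\mathbb N[\mathbb F^{\vee}].$$ Proposition. Let $0\to G'\to G\to G''\to 0$ be an exact sequence of $\mathbb F$-vector space schemes over $k$ (exact as a sequence of fppf sheaves on $\mathrm{Sch}/k$). Then, in the group semiring $\mathbb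 N[\mathbb F^{\vee}]$, $$\mathrm{Ch}_k(G)=\mathrm{Ch}_k(G')\,\mathrm{Ch}_k(G'').$$ -/

import Mathlib

open CategoryTheory AlgebraicGeometry Opposite

universe u v

noncomputable section

namespace VectorSpaceSchemes

/-- A functor `(Sch/S)ᵒᵖ ⥤ Vect/F` is an `F`-vector space scheme over `S` if its underlying functor
to sets is represented by an `S`-scheme which is finite, locally free and of finite presentation
over `S` (finite locally free is the same as finite, flat and of finite presentation). -/
def IsVectorSpaceScheme (F : Type v) [Field F] (S : Scheme.{u}) :
    ObjectProperty ((Over S)ᵒᵖ ⥤ ModuleCat.{u} F) := fun G =>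
  ∃ X : Over S, Nonempty ((G ⋙ CategoryTheory.forget (ModuleCat.{u} F)).RepresentableBy X) ∧
    IsFinite X.hom ∧ Flat X.hom ∧ LocallyOfFinitePresentation X.hom

/-- The category of `F`-vector space schemes over `S`. Its morphisms are the natural
transformations between functors to `F`-vector spaces, that is, the morphisms of group schemes
that commute with the action of `F`. -/
abbrev VectorSpaceScheme (F : Type v) [Field F] (S : Scheme.{u}) :=
  (IsVectorSpaceScheme F S).FullSubcategory

/-- A sequence `0 ⟶ G' ⟶ G ⟶ G'' ⟶ 0` of `F`-vector space schemes over `S` is exact if it is an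
exact sequence of sheaves for the fppf topology on `Sch/S`: `f` identifies `G'` with the kernel of
`g`, and `g` is surjective locally for the fppf topology. -/
structure IsShortExact {F : Type v} [Field F] {S : Scheme.{u}} {G' G G'' : VectorSpaceScheme F S}
    (f : G' ⟶ G) (g : G ⟶ G'') : Prop where
  injective : ∀ T : (Over S)ᵒᵖ, Function.Injective (f.hom.app T)
  exact : ∀ T : (Over S)ᵒᵖ, Function.Exact (f.hom.app T) (g.hom.app T)
  locallySurjective :
    Presheaf.IsLocallySurjective (Scheme.fppfTopology.{u}.over S) g.hom

namespace VectorSpaceScheme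

section

variable {F : Type v} [Field F] {S : Scheme.{u}} (G : VectorSpaceScheme F S)

lemma isRepresentable :
    (G.obj ⋙ CategoryTheory.forget (ModuleCat.{u} F)).IsRepresentable := by
  obtain ⟨X, ⟨h⟩, -⟩ := G.property
  exact h.isRepresentable

/-- The `S`-scheme that represents `G`. -/
def scheme : Over S :=
  haveI := G.isRepresentable
  (G.obj ⋙ CategoryTheory.forget (ModuleCat.{u} F)).reprX

/-- The identification `Hom_S(T, G.scheme) ≃ G(T)`, natural in `T`. -/
def representableBy :
    (G.obj ⋙ CategoryTheory.forget (ModuleCat.{u} F)).RepresentableBy G.scheme :=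
  haveI := G.isRepresentable
  (G.obj ⋙ CategoryTheory.forget (ModuleCat.{u} F)).representableBy

/-- The universal point of `G`, with values in the scheme that represents `G`. -/
def universalPoint : G.obj.obj (op G.scheme) :=
  G.representableBy.homEquiv (𝟙 G.scheme)

/-- The endomorphism `[c]` of the scheme `G` that is multiplication by `c` on all points. -/
def smulHom (c : F) : G.scheme ⟶ G.scheme :=
  G.representableBy.homEquiv.symm (c • G.universalPoint : G.obj.obj (op G.scheme))

end

section

variable {F : Type v} [Field F] {k : Type u} [Field k]
  (G : VectorSpaceScheme F (Spec (CommRingCat.of k)))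

/-- The algebra `A` of global functions of an `F`-vector space scheme `G = Spec A` over `k`. -/
def CoordinateRing : Type u := Γ(G.scheme.left, ⊤)

instance : CommRing G.CoordinateRing :=
  inferInstanceAs (CommRing Γ(G.scheme.left, ⊤))

/-- The structure of `k`-algebra on `A`, given by the structure morphism `G ⟶ Spec k`. -/
instance : Algebra k G.CoordinateRing :=
  RingHom.toAlgebra
    ((Scheme.ΓSpecIso (CommRingCat.of k)).inv ≫ G.scheme.hom.appTop).hom

/-- The coaction of `c : F` on `A`: composition of functions with `[c] : G ⟶ G`. -/
def coaction (c : F) : G.CoordinateRing →ₐ[k] G.CoordinateRing where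
  __ := ((G.smulHom c).left.appTop).hom
  commutes' r := by
    have h := congrArg Scheme.Hom.appTop (Over.w (G.smulHom c))
    rw [Scheme.Hom.comp_appTop] at h
    exact ConcreteCategory.congr_hom h ((Scheme.ΓSpecIso (CommRingCat.of k)).inv r)

/-- The isotypic component `A_χ`: the functions `a` with `[c] a = χ(c) a` for all `c ∈ Fˣ`. -/
def isotypicComponent (χ : Fˣ →* kˣ) : Submodule k G.CoordinateRing where
  carrier := {a | ∀ c : Fˣ, G.coaction (c : F) a = (χ c : k) • a}
  add_mem' ha hb c := by rw [map_add, ha c, hb c, smul_add]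
  zero_mem' c := by rw [map_zero, smul_zero]
  smul_mem' r a ha c := by rw [map_smul, ha c, smul_comm]

/-- The character `Ch_k(G) = ∑_χ dim_k(A_χ) [χ]` of `G`, an element of the semiring `ℕ[F^∨]`, where
`F^∨ = Hom(Fˣ, kˣ)`. -/
def character [Finite F] : MonoidAlgebra ℕ (Fˣ →* kˣ) :=
  letI := Fintype.ofFinite (Fˣ →* kˣ)
  ∑ χ : Fˣ →* kˣ, MonoidAlgebra.single χ (Module.finrank k (G.isotypicComponent χ))

end

end VectorSpaceScheme

end VectorSpaceSchemes

end

/-! Write `G = Spec A`, `G' = Spec A'`, `G'' = Spec B`, let `I` be the augmentation ideal of `B`,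
and let `H = Fˣ`. Then `A` is a `B`-module with a semilinear action of `H`, and `A' = A/IA`
equivariantly. The claim is dim `A_χ` = ∑_ψ dim `A'_ψ` · dim `B_{χ/ψ}`, an instance of
`finrank_isotypic_eq_sum`. The order of `H` is invertible in `k` and `k` has enough roots of unity,
so all these spaces split into isotypic parts.

Geometry enters twice. First, `G → G''` is a `G'`-torsor, trivial fppf-locally, and `B` is
semilocal, so `A` is free over `B` of rank dim `A'` (`nonempty_basis`). Second, `c ≠ 1` in `H` fixes
only the zero point of `G''`, because `c - 1` is invertible in `F`
(`ker_counit_le_displacementIdeal`).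

Since `B` is artinian, a high power of `I` is generated by an invariant idempotent `u`, and
everything splits along `u` and `1 - u`. On the part of `1 - u` the ideal `I` is nilpotent:
equivariant lifts of a basis of `A'` generate by Nakayama, which gives "≤" for every `χ`; the totals
over `χ` agree by freeness, so equality holds throughout. On the part of `u` the group acts freely,
so `u` is a product of semi-invariants of characters `χ⁻¹` and `χ`
(`exists_mul_eq_of_forall_mem_displacementIdeal`). Hence all isotypic parts have the same dimension,
and only the total dimensions need comparing. -/

noncomputable section

namespace VectorSpaceSchemes

open scoped TensorProduct

/-! ### Isotypic decomposition for a finite commutative group. -/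

section Isotypic

variable {k : Type*} [Field k] {H : Type*} [CommGroup H]
  {V : Type*} [AddCommGroup V] [Module k V] {V' : Type*} [AddCommGroup V'] [Module k V']
  (ρ : Representation k H V) (ρ' : Representation k H V')

/-- The `χ`-isotypic part of a representation of a commutative group. -/
def isotypic (χ : H →* kˣ) : Submodule k V where
  carrier := {v | ∀ h, ρ h v = (χ h : k) • v}
  add_mem' ha hb c := by rw [map_add, ha c, hb c, smul_add]
  zero_mem' c := by rw [map_zero, smul_zero]
  smul_mem' r a ha c := by rw [map_smul, ha c, smul_comm]

variable {ρ ρ'}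

lemma mem_isotypic {χ : H →* kˣ} {v : V} :
    v ∈ isotypic ρ χ ↔ ∀ h, ρ h v = (χ h : k) • v := Iff.rfl

lemma map_mem_isotypic (φ : V →ₗ[k] V') (hφ : ∀ h v, φ (ρ h v) = ρ' h (φ v)) {χ : H →* kˣ} {v : V}
    (hv : v ∈ isotypic ρ χ) : φ v ∈ isotypic ρ' χ := fun h => by
  rw [← hφ, hv h, map_smul]

variable [Fintype H]

variable (ρ) in
/-- The projector onto the `χ`-isotypic part. -/
def isotypicProj (χ : H →* kˣ) : V →ₗ[k] V :=
  (Fintype.card H : k)⁻¹ • ∑ h, ((χ h)⁻¹ : kˣ).val • ρ h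

lemma isotypicProj_apply (χ : H →* kˣ) (v : V) :
    isotypicProj ρ χ v = (Fintype.card H : k)⁻¹ • ∑ h, ((χ h)⁻¹ : kˣ).val • ρ h v := by
  simp [isotypicProj]

lemma isotypicProj_mem_of_invariant (χ : H →* kˣ) {W : Submodule k V}
    (hW : ∀ h, ∀ w ∈ W, ρ h w ∈ W) {v : V} (hv : v ∈ W) : isotypicProj ρ χ v ∈ W := by
  rw [isotypicProj_apply]
  exact W.smul_mem _ (W.sum_mem fun h _ => W.smul_mem _ (hW h v hv))

lemma map_isotypicProj (φ : V →ₗ[k] V') (hφ : ∀ h v, φ (ρ h v) = ρ' h (φ v)) (χ : H →* kˣ) (v : V) :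
    φ (isotypicProj ρ χ v) = isotypicProj ρ' χ (φ v) := by
  simp [isotypicProj_apply, hφ]

lemma isotypicProj_mem (χ : H →* kˣ) (v : V) : isotypicProj ρ χ v ∈ isotypic ρ χ := by
  intro g
  rw [isotypicProj_apply, map_smul, smul_comm]
  congr 1
  rw [map_sum, Finset.smul_sum]
  refine Fintype.sum_equiv (Equiv.mulLeft g) _ _ fun h => ?_
  rw [Equiv.coe_mulLeft, map_smul, map_mul ρ, Module.End.mul_apply, smul_smul]
  congr 1
  rw [map_mul, ← Units.val_mul, mul_inv, mul_inv_cancel_left]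

variable (hH : (Fintype.card H : k) ≠ 0)
include hH

lemma isotypicProj_of_mem {χ : H →* kˣ} {v : V} (hv : v ∈ isotypic ρ χ) :
    isotypicProj ρ χ v = v := by
  have (h : H) : ((χ h)⁻¹ : kˣ).val • ρ h v = v := by
    rw [hv h, smul_smul, ← Units.val_mul, inv_mul_cancel, Units.val_one, one_smul]
  rw [isotypicProj_apply, Finset.sum_congr rfl fun h _ => this h, Finset.sum_const,
    Finset.card_univ, ← Nat.cast_smul_eq_nsmul k, smul_smul, inv_mul_cancel₀ hH, one_smul]

-- Row orthogonality: the nontrivial character `ψ / χ` sums to zero over `H`.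
omit hH in
lemma isotypicProj_of_mem_of_ne {χ ψ : H →* kˣ} (hχ : χ ≠ ψ) {v : V} (hv : v ∈ isotypic ρ ψ) :
    isotypicProj ρ χ v = 0 := by
  have (h : H) : ((χ h)⁻¹ : kˣ).val • ρ h v = (((ψ / χ) h : kˣ) : k) • v := by
    rw [hv h, smul_smul, ← Units.val_mul, MonoidHom.div_apply, div_eq_inv_mul]
  rw [isotypicProj_apply, Finset.sum_congr rfl fun h _ => this h, ← Finset.sum_smul]
  have h0 := sum_hom_units_eq_zero ((Units.coeHom k).comp (ψ / χ)) fun h => hχ <| by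
    refine (div_eq_one.mp (MonoidHom.ext fun x => Units.ext ?_)).symm
    exact DFunLike.congr_fun h x
  simp only [MonoidHom.comp_apply, Units.coeHom_apply] at h0
  rw [h0, zero_smul, smul_zero]

variable [HasEnoughRootsOfUnity k (Monoid.exponent H)] [Fintype (H →* kˣ)]

/-- Column orthogonality: with enough roots of unity there are `|H|` characters and they separate
the elements of `H`. -/
lemma sum_isotypicProj (v : V) : ∑ χ : H →* kˣ, isotypicProj ρ χ v = v := by
  classical
  have key (h : H) : ∑ χ : H →* kˣ, ((χ h)⁻¹ : kˣ).val =
      if h = 1 then (Fintype.card H : k) else 0 := by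
    split_ifs with h1
    · subst h1
      have := CommGroup.card_monoidHom_of_hasEnoughRootsOfUnity H k
      rw [Nat.card_eq_fintype_card, Nat.card_eq_fintype_card] at this
      simp [this]
    · obtain ⟨φ, hφ⟩ := CommGroup.exists_apply_ne_one_of_hasEnoughRootsOfUnity H k
        (inv_ne_one.mpr h1)
      have := sum_hom_units_eq_zero ((Units.coeHom k).comp (MonoidHom.eval h⁻¹ : (H →* kˣ) →* kˣ))
        fun e => hφ (Units.ext (DFunLike.congr_fun e φ))
      simpa using this
  simp only [isotypicProj_apply]
  rw [← Finset.smul_sum, Finset.sum_comm]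
  simp only [← Finset.sum_smul, key]
  simp [smul_smul, inv_mul_cancel₀ hH]

/-- The dimensions of the isotypic parts of an invariant subspace add up to its dimension. -/
lemma sum_finrank_isotypic_inf [FiniteDimensional k V] {W : Submodule k V}
    (hW : ∀ h, ∀ w ∈ W, ρ h w ∈ W) :
    ∑ χ : H →* kˣ, Module.finrank k ↥(isotypic ρ χ ⊓ W) = Module.finrank k W := by
  classical
  rw [← Module.finrank_pi_fintype k]
  refine LinearEquiv.finrank_eq
    { toFun := fun f => ∑ χ, ⟨(f χ : V), (f χ).2.2⟩
      invFun := fun w χ => ⟨isotypicProj ρ χ w, isotypicProj_mem χ _,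
        isotypicProj_mem_of_invariant χ hW w.2⟩
      map_add' := fun f g => by
        rw [← Finset.sum_add_distrib]; rfl
      map_smul' := fun c f => by
        rw [RingHom.id_apply, Finset.smul_sum]; rfl
      left_inv := fun f => by
        ext χ
        simp only [AddSubmonoidClass.coe_finsetSum, map_sum]
        rw [Finset.sum_eq_single χ (fun ψ _ h => isotypicProj_of_mem_of_ne h.symm (f ψ).2.1)
          (by simp), isotypicProj_of_mem hH (f χ).2.1]
      right_inv := fun w => by
        ext
        simp [sum_isotypicProj hH] }

end Isotypic

/-! ### Semi-invariants of a free action. -/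

section GaloisUnits

variable {k : Type*} [Field k] {H : Type*} [CommGroup H] {B : Type*} [CommRing B] [Algebra k B]

/-- The representation underlying an action by algebra automorphisms. -/
abbrev toRep (ρ : H →* (B →ₐ[k] B)) : Representation k H B := AlgHom.toEnd.comp ρ

variable {ρ : H →* (B →ₐ[k] B)}

lemma mul_mem_isotypic {χ ψ : H →* kˣ} {a b : B} (ha : a ∈ isotypic (toRep ρ) χ)
    (hb : b ∈ isotypic (toRep ρ) ψ) : a * b ∈ isotypic (toRep ρ) (χ * ψ) := fun h => by
  have h1 : ρ h a = (χ h : k) • a := ha h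
  have h2 : ρ h b = (ψ h : k) • b := hb h
  change ρ h (a * b) = _
  rw [map_mul, h1, h2, smul_mul_smul_comm, MonoidHom.mul_apply, Units.val_mul]

lemma mul_mem_isotypic_of_eq {χ ψ φ : H →* kˣ} (h : χ * ψ = φ) {a b : B}
    (ha : a ∈ isotypic (toRep ρ) χ) (hb : b ∈ isotypic (toRep ρ) ψ) :
    a * b ∈ isotypic (toRep ρ) φ :=
  h ▸ mul_mem_isotypic ha hb

lemma mem_isotypic_one {b : B} : b ∈ isotypic (toRep ρ) 1 ↔ ∀ h, ρ h b = b := by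
  simp [mem_isotypic]

variable (ρ) in
/-- The subalgebra of invariants. -/
def invariantSubalgebra : Subalgebra k B where
  carrier := {b | ∀ h, ρ h b = b}
  mul_mem' ha hb h := by rw [map_mul, ha h, hb h]
  add_mem' ha hb h := by rw [map_add, ha h, hb h]
  algebraMap_mem' r h := (ρ h).commutes r

lemma isotypicProj_mul [Fintype H] {χ ψ : H →* kˣ} {a b : B} (hb : b ∈ isotypic (toRep ρ) χ) :
    isotypicProj (toRep ρ) (ψ * χ) (a * b) = isotypicProj (toRep ρ) ψ a * b := by
  rw [isotypicProj_apply, isotypicProj_apply, smul_mul_assoc, Finset.sum_mul]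
  congr 1
  refine Finset.sum_congr rfl fun h _ => ?_
  have h2 : ρ h b = (χ h : k) • b := hb h
  change _ • ρ h (a * b) = _ • ρ h a * b
  rw [map_mul, h2, mul_smul_comm, smul_smul, smul_mul_assoc]
  congr 1
  rw [MonoidHom.mul_apply, ← Units.val_mul, mul_inv, inv_mul_cancel_right]

/-- The ideal generated by the elements `σ b - b`; it cuts out the fixed points of `σ`. -/
def displacementIdeal (σ : B →ₐ[k] B) : Ideal B := Ideal.span (Set.range fun b => σ b - b)

/-- The tensor `t` is a function on `Spec B × Spec B` that vanishes on the graph of `σ` and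
restricts to `x` on the diagonal. -/
lemma exists_tensor_of_mem_displacementIdeal (σ : B →ₐ[k] B) {x : B}
    (hx : x ∈ displacementIdeal σ) :
    ∃ t : B ⊗[k] B, Algebra.TensorProduct.productMap (AlgHom.id k B) (AlgHom.id k B) t = x ∧
      Algebra.TensorProduct.productMap (AlgHom.id k B) σ t = 0 := by
  induction hx using Submodule.span_induction with
  | mem x hx =>
    obtain ⟨b, rfl⟩ := hx
    exact ⟨σ b ⊗ₜ 1 - 1 ⊗ₜ b, by simp, by simp⟩
  | zero => exact ⟨0, map_zero _, map_zero _⟩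
  | add x y _ _ hx hy =>
    obtain ⟨s, rfl, hs⟩ := hx
    obtain ⟨t, rfl, ht⟩ := hy
    exact ⟨s + t, map_add _ _ _, by rw [map_add, hs, ht, add_zero]⟩
  | smul a x _ hx =>
    obtain ⟨s, rfl, hs⟩ := hx
    exact ⟨(a ⊗ₜ 1) * s, by simp, by simp [hs]⟩

variable [Fintype H] {u : B} (hu : IsIdempotentElem u) (hu' : ∀ h, ρ h u = u)
  (hmem : ∀ h ≠ 1, u ∈ displacementIdeal (ρ h))

-- Multiply the tensors that separate the diagonal from each graph, `h ≠ 1`. The extra factor `u ⊗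
-- 1` covers trivial `H`, where the product is empty.
include hu hmem in
lemma exists_tensor_of_forall_mem_displacementIdeal :
    ∃ t : B ⊗[k] B, Algebra.TensorProduct.productMap (AlgHom.id k B) (ρ 1) t = u ∧
      ∀ h ≠ 1, Algebra.TensorProduct.productMap (AlgHom.id k B) (ρ h) t = 0 := by
  classical
  choose! t ht1 ht0 using fun h hh => exists_tensor_of_mem_displacementIdeal (ρ h) (hmem h hh)
  refine ⟨(u ⊗ₜ 1) * ∏ h ∈ Finset.univ.erase 1, t h, ?_, fun h hh => ?_⟩
  · rw [map_mul, map_prod, map_one, show (1 : B →ₐ[k] B) = AlgHom.id k B from rfl,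
      Finset.prod_congr rfl fun h hh => ht1 h (Finset.ne_of_mem_erase hh)]
    simp [← pow_succ', hu.pow_succ_eq]
  · rw [map_mul, map_prod, Finset.prod_eq_zero (Finset.mem_erase.mpr ⟨hh, Finset.mem_univ h⟩)
      (ht0 h hh), mul_zero]

variable (hH : (Fintype.card H : k) ≠ 0)
include hu hu' hmem hH

/-- If `t = ∑ aᵢ ⊗ bᵢ` is the separating tensor and `p_χ` the projector, then `∑ aᵢ p_χ(bᵢ) = |H|⁻¹
u`, as only `h = 1` contributes. Projecting onto invariants replaces each `aᵢ` by its
`χ⁻¹`-component. -/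
lemma mem_isotypic_mul_isotypic (χ : H →* kˣ) :
    u ∈ isotypic (toRep ρ) χ⁻¹ * isotypic (toRep ρ) χ := by
  obtain ⟨t, ht1, ht0⟩ := exists_tensor_of_forall_mem_displacementIdeal hu hmem
  have hν (s : B ⊗[k] B) : LinearMap.mul' k B ((isotypicProj (toRep ρ) χ).lTensor B s) =
      (Fintype.card H : k)⁻¹ • ∑ h, ((χ h)⁻¹ : kˣ).val •
        Algebra.TensorProduct.productMap (AlgHom.id k B) (ρ h) s := by
    induction s with
    | zero => simp
    | add x y hx hy => simp only [map_add, hx, hy, smul_add, Finset.sum_add_distrib]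
    | tmul a b =>
      simp only [LinearMap.lTensor_tmul, LinearMap.mul'_apply, isotypicProj_apply,
        Algebra.TensorProduct.productMap_apply_tmul, mul_smul_comm, Finset.mul_sum]
      rfl
  have hproj (s : B ⊗[k] B) :
      isotypicProj (toRep ρ) 1 (LinearMap.mul' k B ((isotypicProj (toRep ρ) χ).lTensor B s)) ∈
        isotypic (toRep ρ) χ⁻¹ * isotypic (toRep ρ) χ := by
    induction s with
    | zero => simp
    | add x y hx hy => simpa only [map_add] using Submodule.add_mem _ hx hy
    | tmul a b =>
      rw [LinearMap.lTensor_tmul, LinearMap.mul'_apply, ← inv_mul_cancel χ,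
        isotypicProj_mul (isotypicProj_mem χ b)]
      exact Submodule.mul_mem_mul (isotypicProj_mem _ _) (isotypicProj_mem _ _)
  have h := hproj t
  rw [hν, Finset.sum_eq_single 1 (fun h _ hh => by rw [ht0 h hh, smul_zero]) (by simp), ht1,
    map_one, inv_one, Units.val_one, one_smul, map_smul,
    isotypicProj_of_mem hH (mem_isotypic_one.mpr hu')] at h
  simpa [smul_smul, hH] using Submodule.smul_mem _ (Fintype.card H : k) h

/-- An invariant idempotent on which a finite commutative group acts freely factors through
isotypic elements of any given character. -/
lemma exists_mul_eq_of_forall_mem_displacementIdeal [FiniteDimensional k B] (χ : H →* kˣ) :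
    ∃ x ∈ isotypic (toRep ρ) χ⁻¹, ∃ y ∈ isotypic (toRep ρ) χ, x * y = u := by
  classical
  let R := invariantSubalgebra ρ
  have : IsArtinianRing R := IsArtinianRing.of_finite k R
  have := Fintype.ofFinite (MaximalSpectrum R)
  let w : R := ⟨u, hu'⟩
  have hR {x y : B} (hx : x ∈ isotypic (toRep ρ) χ⁻¹) (hy : y ∈ isotypic (toRep ρ) χ) :
      x * y ∈ R :=
    mem_isotypic_one.mp (mul_mem_isotypic_of_eq (inv_mul_cancel χ) hx hy)
  -- Passing from a sum of products to a single product is local on the semilocal ring `R` of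
  -- invariants: if all products lay in `m`, so would `u`.
  have loc (m : MaximalSpectrum R) : ∃ x : isotypic (toRep ρ) χ⁻¹, ∃ y : isotypic (toRep ρ) χ,
      w ∉ m.asIdeal → (⟨x * y, hR x.2 y.2⟩ : R) ∉ m.asIdeal := by
    by_contra! hc
    have hle : isotypic (toRep ρ) χ⁻¹ * isotypic (toRep ρ) χ ≤
        (m.asIdeal.restrictScalars k).map R.val.toLinearMap :=
      Submodule.mul_le.mpr fun x hx y hy => ⟨⟨x * y, hR hx hy⟩, (hc ⟨x, hx⟩ ⟨y, hy⟩).2, rfl⟩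
    obtain ⟨z, hz, hzu⟩ := hle (mem_isotypic_mul_isotypic hu hu' hmem hH χ)
    have : z = w := Subtype.ext hzu
    exact (hc 0 0).1 (this ▸ hz)
  choose x y hxy using loc
  have hcop : Pairwise (Function.onFun IsCoprime fun m : MaximalSpectrum R => m.asIdeal) :=
    fun m n hmn => Ideal.isCoprime_of_isMaximal fun h => hmn (MaximalSpectrum.ext h)
  -- Chinese remainder theorem: `c m` is `1` modulo `m` and `0` modulo the other maximal ideals. It
  -- glues the local choices into `X` and `Y`.
  choose c hc using fun m : MaximalSpectrum R =>
    Ideal.pi_quotient_surjective hcop (Pi.single m 1)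
  let X : isotypic (toRep ρ) χ⁻¹ := ∑ m, ⟨c m * (x m : B),
    mul_mem_isotypic_of_eq (one_mul χ⁻¹) (mem_isotypic_one.mpr (c m).2) (x m).2⟩
  let Y : isotypic (toRep ρ) χ := ∑ m, ⟨c m * (y m : B),
    mul_mem_isotypic_of_eq (one_mul χ) (mem_isotypic_one.mpr (c m).2) (y m).2⟩
  let z : R := ⟨X * Y, hR X.2 Y.2⟩
  have hz : z = ∑ m, ∑ n, c m * c n * ⟨x m * y n, hR (x m).2 (y n).2⟩ := by
    apply Subtype.ext
    simp only [z, X, Y, AddSubmonoidClass.coe_finsetSum, Finset.sum_mul_sum, MulMemClass.coe_mul]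
    exact Finset.sum_congr rfl fun m _ => Finset.sum_congr rfl fun n _ => by ring
  have hzm (m : MaximalSpectrum R) : Ideal.Quotient.mk m.asIdeal z =
      Ideal.Quotient.mk m.asIdeal ⟨x m * y m, hR (x m).2 (y m).2⟩ := by
    rw [hz]
    simp only [map_sum, map_mul, hc]
    rw [Finset.sum_eq_single m, Finset.sum_eq_single m] <;> simp +contextual [eq_comm]
  -- Modulo a maximal ideal containing `w` this is `1`; modulo any other one `w` is `1` and `z` is
  -- the nonzero local product.
  have hunit : IsUnit (w * z + (1 - w)) := by
    by_contra hn
    obtain ⟨m, hm, hmem⟩ := exists_max_ideal_of_mem_nonunits hn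
    have hww : w * w = w := Subtype.ext hu
    by_cases hwm : w ∈ m
    · refine hm.ne_top ((Ideal.eq_top_iff_one m).mpr ?_)
      have := m.add_mem (m.sub_mem hmem (m.mul_mem_right z hwm)) hwm
      ring_nf at this
      exact this
    · have hwz : w * z ∈ m := by
        have := m.mul_mem_left w hmem
        rwa [mul_add, mul_sub, mul_one, hww, sub_self, add_zero, ← mul_assoc, hww] at this
      have hz' := (hm.isPrime.mem_or_mem hwz).resolve_left hwm
      refine hxy ⟨m, hm⟩ hwm ?_
      rw [← Ideal.Quotient.eq_zero_iff_mem] at hz' ⊢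
      exact (hzm ⟨m, hm⟩).symm.trans hz'
  obtain ⟨v, hv⟩ := hunit
  have hvw : (X : B) * Y * u * (↑v⁻¹ : R) = u := by
    have h1 : (w * z + (1 - w)) * ↑v⁻¹ = 1 := by rw [← hv, Units.mul_inv]
    have hww : w * w = w := Subtype.ext hu
    have h2 : z * w * ↑v⁻¹ = w := by
      linear_combination w * h1 - (z - 1) * (↑v⁻¹ : R) * hww
    exact congrArg Subtype.val h2
  refine ⟨X * u, mul_mem_isotypic_of_eq (mul_one χ⁻¹) X.2 (mem_isotypic_one.mpr hu'),
    Y * (↑v⁻¹ : R), mul_mem_isotypic_of_eq (mul_one χ) Y.2 (mem_isotypic_one.mpr (↑v⁻¹ : R).2), ?_⟩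
  linear_combination hvw

end GaloisUnits

/-! ### The summand cut out by an idempotent. -/

section IdempotentPart

variable {k : Type*} [Field k] {B : Type*} [CommRing B] [Algebra k B]
  (M : Type*) [AddCommGroup M] [Module k M] [Module B M] [IsScalarTower k B M]

variable (k) in
/-- The subspace of a module on which an idempotent acts as the identity. -/
def idempotentPart (x : B) : Submodule k M where
  carrier := {m | x • m = m}
  add_mem' ha hb := by rw [Set.mem_ofPred_eq, smul_add, ha, hb]
  zero_mem' := smul_zero x
  smul_mem' r a ha := by
    rw [Set.mem_ofPred_eq, ← smul_one_smul B r a, smul_comm, show x • a = a from ha]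

variable {M}

lemma mem_idempotentPart {x : B} {m : M} : m ∈ idempotentPart k M x ↔ x • m = m := Iff.rfl

lemma smul_mem_idempotentPart {x : B} (hx : IsIdempotentElem x) (m : M) :
    x • m ∈ idempotentPart k M x := by
  rw [mem_idempotentPart, smul_smul, hx.eq]

lemma finrank_idempotentPart [FiniteDimensional k B] {ι : Type*} [Fintype ι] (b : Module.Basis ι B M) (x : B) :
    Module.finrank k (idempotentPart k M x) =
      Fintype.card ι * Module.finrank k (idempotentPart k B x) := by
  have hpi : Module.finrank k (ι → idempotentPart k B x) =
      Fintype.card ι * Module.finrank k (idempotentPart k B x) := by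
    rw [Module.finrank_pi_fintype, Finset.sum_const, Finset.card_univ, smul_eq_mul]
  rw [← hpi]
  have hk (c : k) (m : M) (i : ι) : b.repr (c • m) i = c • b.repr m i := by
    rw [← smul_one_smul B c m, map_smul, Finsupp.smul_apply, smul_assoc, one_smul]
  exact LinearEquiv.finrank_eq
    { toFun := fun m i => ⟨b.repr m i, by
        rw [mem_idempotentPart, ← Finsupp.smul_apply, ← map_smul, m.2]⟩
      invFun := fun f => ⟨b.equivFun.symm fun i => f i, by
        rw [mem_idempotentPart, ← map_smul]
        exact congrArg _ (funext fun i => (f i).2)⟩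
      map_add' := fun m n => by ext; simp
      map_smul' := fun c m => by ext; simp [hk]
      left_inv := fun m => by
        ext
        exact b.equivFun.symm_apply_apply (m : M)
      right_inv := fun f => by
        ext i
        exact congrFun (b.equivFun.apply_symm_apply fun i => (f i : B)) i }

end IdempotentPart

/-! ### Modules with a semilinear action. -/

section Semilinear

variable {k : Type*} [Field k] {H : Type*} [CommGroup H] {B : Type*} [CommRing B] [Algebra k B]
  {ρ : H →* (B →ₐ[k] B)}
  {M : Type*} [AddCommGroup M] [Module k M] [Module B M] [IsScalarTower k B M]
  {τ : Representation k H M} (hτ : ∀ h (b : B) (m : M), τ h (b • m) = ρ h b • τ h m)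
include hτ

lemma smul_mem_isotypic {χ ψ φ : H →* kˣ} (h : χ * ψ = φ) {b : B} {m : M}
    (hb : b ∈ isotypic (toRep ρ) χ) (hm : m ∈ isotypic τ ψ) : b • m ∈ isotypic τ φ := fun g => by
  have hb' : ρ g b = (χ g : k) • b := hb g
  rw [hτ, hb', hm g, ← h, MonoidHom.mul_apply, Units.val_mul, mul_smul, smul_assoc,
    ← smul_one_smul B (ψ g : k) m, smul_comm b, smul_one_smul]

lemma isotypicProj_smul [Fintype H] {χ ψ φ : H →* kˣ} (hχ : χ * ψ = φ) (b : B) {m : M}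
    (hm : m ∈ isotypic τ ψ) :
    isotypicProj τ φ (b • m) = isotypicProj (toRep ρ) χ b • m := by
  rw [isotypicProj_apply, isotypicProj_apply, smul_assoc, Finset.sum_smul]
  congr 1
  refine Finset.sum_congr rfl fun h _ => ?_
  rw [hτ, hm h, ← hχ, ← smul_one_smul B (ψ h : k) m, smul_comm (ρ h b), smul_one_smul, smul_smul,
    MonoidHom.mul_apply, ← Units.val_mul, mul_inv, inv_mul_cancel_right, smul_assoc]
  rfl

lemma apply_mem_idempotentPart {u : B} (hu' : ∀ h, ρ h u = u) (h : H) (m : M)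
    (hm : m ∈ idempotentPart k M u) : τ h m ∈ idempotentPart k M u := by
  rw [mem_idempotentPart] at hm ⊢
  conv_rhs => rw [← hm]
  rw [hτ, hu']

lemma finrank_isotypic_eq_add [FiniteDimensional k M] {u : B} (hu : IsIdempotentElem u)
    (hu' : ∀ h, ρ h u = u) (χ : H →* kˣ) :
    Module.finrank k (isotypic τ χ) =
      Module.finrank k ↥(isotypic τ χ ⊓ idempotentPart k M (1 - u)) +
        Module.finrank k ↥(isotypic τ χ ⊓ idempotentPart k M u) := by
  rw [← Submodule.finrank_sup_add_finrank_inf_eq]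
  have h0 : isotypic τ χ ⊓ idempotentPart k M (1 - u) ⊓ (isotypic τ χ ⊓ idempotentPart k M u) =
      ⊥ := by
    rw [eq_bot_iff]
    rintro m ⟨⟨-, h1⟩, -, h2⟩
    rw [SetLike.mem_coe, mem_idempotentPart] at h1 h2
    rw [sub_smul, one_smul, h2, sub_self] at h1
    exact h1.symm
  have h1 : isotypic τ χ ⊓ idempotentPart k M (1 - u) ⊔ isotypic τ χ ⊓ idempotentPart k M u =
      isotypic τ χ := by
    refine le_antisymm (sup_le inf_le_left inf_le_left) fun m hm => ?_
    have hum : u • m ∈ isotypic τ χ :=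
      smul_mem_isotypic hτ (one_mul χ) (mem_isotypic_one.mpr hu') hm
    refine Submodule.mem_sup.mpr ⟨(1 - u) • m, ⟨?_, smul_mem_idempotentPart hu.one_sub m⟩, u • m,
      ⟨hum, smul_mem_idempotentPart hu m⟩, by rw [← add_smul, sub_add_cancel, one_smul]⟩
    rw [sub_smul, one_smul]
    exact sub_mem hm hum
  rw [h0, h1, finrank_bot, add_zero]

variable [Fintype H] {u : B} (hu : IsIdempotentElem u) (hu' : ∀ h, ρ h u = u)
  (hmem : ∀ h ≠ 1, u ∈ displacementIdeal (ρ h)) (hH : (Fintype.card H : k) ≠ 0)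
  [FiniteDimensional k B]
include hu hu' hmem hH

/-- Multiplications by the semi-invariants `y` and `x` are mutually inverse, since `x * y = u` acts
as the identity here. -/
lemma finrank_isotypic_inf_idempotentPart_eq (χ : H →* kˣ) :
    Module.finrank k ↥(isotypic τ 1 ⊓ idempotentPart k M u) =
      Module.finrank k ↥(isotypic τ χ ⊓ idempotentPart k M u) := by
  obtain ⟨x, hx, y, hy, hxy⟩ := exists_mul_eq_of_forall_mem_displacementIdeal hu hu' hmem hH χ
  have hW (b : B) {m : M} (hm : m ∈ idempotentPart k M u) : b • m ∈ idempotentPart k M u := by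
    rw [mem_idempotentPart] at hm ⊢
    rw [smul_comm, hm]
  have hk (b : B) (c : k) (m : M) : b • c • m = c • b • m := by
    rw [← smul_one_smul B c m, smul_comm, smul_one_smul]
  exact LinearEquiv.finrank_eq
    { toFun := fun m => ⟨y • m, smul_mem_isotypic hτ (mul_one χ) hy m.2.1, hW y m.2.2⟩
      invFun := fun m => ⟨x • m, smul_mem_isotypic hτ (inv_mul_cancel χ) hx m.2.1, hW x m.2.2⟩
      map_add' := fun m n => by ext; simp
      map_smul' := fun c m => by ext; simp [hk]
      left_inv := fun m => by
        ext
        change x • y • (m : M) = m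
        rw [smul_smul, hxy]
        exact m.2.2
      right_inv := fun m => by
        ext
        change y • x • (m : M) = m
        rw [smul_smul, mul_comm, hxy]
        exact m.2.2 }

lemma card_mul_finrank_isotypic_inf_idempotentPart [FiniteDimensional k M]
    [HasEnoughRootsOfUnity k (Monoid.exponent H)] [Fintype (H →* kˣ)] (χ : H →* kˣ) :
    Fintype.card (H →* kˣ) * Module.finrank k ↥(isotypic τ χ ⊓ idempotentPart k M u) =
      Module.finrank k (idempotentPart k M u) := by
  rw [← sum_finrank_isotypic_inf hH (apply_mem_idempotentPart hτ hu'),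
    ← finrank_isotypic_inf_idempotentPart_eq hτ hu hu' hmem hH χ]
  simp [← finrank_isotypic_inf_idempotentPart_eq hτ hu hu' hmem hH]

end Semilinear

/-! ### The convolution formula for dimensions. -/

section Convolution

variable {k : Type*} [Field k] {H : Type*} [CommGroup H] [Fintype H] [Fintype (H →* kˣ)]
  [HasEnoughRootsOfUnity k (Monoid.exponent H)] (hH : (Fintype.card H : k) ≠ 0)
  {B : Type*} [CommRing B] [Algebra k B] [FiniteDimensional k B] {ρ : H →* (B →ₐ[k] B)}
  {M : Type*} [AddCommGroup M] [Module k M] [Module B M] [IsScalarTower k B M]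
  [FiniteDimensional k M]
  {τ : Representation k H M} (hτ : ∀ h (b : B) (m : M), τ h (b • m) = ρ h b • τ h m)
  {M' : Type*} [AddCommGroup M'] [Module k M'] [FiniteDimensional k M']
  {τ' : Representation k H M'} (π : M →ₗ[k] M') (hπτ : ∀ h m, π (τ h m) = τ' h (π m))
  (hπ : Function.Surjective π)
  {I : Ideal B} (hker : ∀ m, π m = 0 → m ∈ I • (⊤ : Submodule B M))
include hH hτ hπτ hπ hker

-- Equivariant Nakayama: isotypic lifts of `M'` generate `M` modulo `I ^ n`, which `e` kills. So the
-- `χ`-part of `e M` is spanned by products of a lift of character `ψ` with an element of `e B` of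
-- character `χ / ψ`.
omit [FiniteDimensional k M] in
lemma finrank_isotypic_inf_idempotentPart_le {e : B} (he : IsIdempotentElem e)
    (he' : ∀ h, ρ h e = e) {n : ℕ} (hn : ∀ x ∈ I ^ n, e * x = 0) (χ : H →* kˣ) :
    Module.finrank k ↥(isotypic τ χ ⊓ idempotentPart k M e) ≤
      ∑ ψ : H →* kˣ, Module.finrank k (isotypic τ' ψ) *
        Module.finrank k ↥(isotypic (toRep ρ) (χ / ψ) ⊓ idempotentPart k B e) := by
  have hsec (ψ : H →* kˣ) : ∃ s : isotypic τ' ψ →ₗ[k] isotypic τ ψ, ∀ a, π (s a) = a := by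
    let p : isotypic τ ψ →ₗ[k] isotypic τ' ψ :=
      π.restrict fun m hm => map_mem_isotypic π hπτ hm
    have hp : Function.Surjective p := fun a => by
      obtain ⟨m, hm⟩ := hπ a
      refine ⟨⟨isotypicProj τ ψ m, isotypicProj_mem ψ m⟩, Subtype.ext ?_⟩
      change π (isotypicProj τ ψ m) = a
      rw [map_isotypicProj π hπτ, hm, isotypicProj_of_mem hH a.2]
    obtain ⟨s, hs⟩ := p.exists_rightInverse_of_surjective (LinearMap.range_eq_top.mpr hp)
    exact ⟨s, fun a => congrArg Subtype.val (LinearMap.congr_fun hs a)⟩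
  choose s hs using hsec
  let N : Submodule B M := Submodule.span B (⋃ ψ, Set.range fun a => (s ψ a : M))
  have hN (j : ℕ) : N ⊔ I ^ j • (⊤ : Submodule B M) = ⊤ := by
    induction j with
    | zero => simp
    | succ j ih =>
      have h1 : N ⊔ I • (⊤ : Submodule B M) = ⊤ := by
        refine eq_top_iff.mpr fun m _ => ?_
        have hm : m - ∑ ψ, (s ψ ⟨isotypicProj τ' ψ (π m), isotypicProj_mem ψ _⟩ : M) ∈
            I • (⊤ : Submodule B M) := by
          refine hker _ ?_
          simp [hs, sum_isotypicProj hH]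
        rw [← add_sub_cancel (∑ ψ, (s ψ ⟨isotypicProj τ' ψ (π m), isotypicProj_mem ψ _⟩ : M)) m]
        refine Submodule.add_mem_sup (Submodule.sum_mem _ fun ψ _ => ?_) hm
        exact Submodule.subset_span (Set.mem_iUnion.mpr ⟨ψ, _, rfl⟩)
      rw [eq_top_iff]
      calc (⊤ : Submodule B M) = N ⊔ I • (N ⊔ I ^ j • ⊤) := by rw [ih, h1]
        _ ≤ N ⊔ I ^ (j + 1) • ⊤ := by
          rw [Submodule.smul_sup, ← Submodule.mul_smul, ← pow_succ', ← sup_assoc]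
          exact sup_le_sup_right (sup_le le_rfl Submodule.smul_le_right) _
  let E (ψ : H →* kˣ) := isotypic (toRep ρ) (χ / ψ) ⊓ idempotentPart k B e
  -- The source of `Θ` has the dimension on the right-hand side; it remains to see that its range
  -- contains the left-hand space.
  let Θ : (∀ ψ, isotypic τ' ψ ⊗[k] E ψ) →ₗ[k] M := ∑ ψ, TensorProduct.lift
    (LinearMap.mk₂ k (fun (a : isotypic τ' ψ) (b : E ψ) => (b : B) • (s ψ a : M))
      (fun a a' b => by simp) (fun c a b => by
        simp only [map_smul, Submodule.coe_smul]
        rw [← smul_one_smul B c (s ψ a : M), smul_comm, smul_one_smul])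
      (fun a b b' => by simp [add_smul]) (fun c a b => by simp)) ∘ₗ LinearMap.proj ψ
  have hΘ (ψ : H →* kˣ) (a : isotypic τ' ψ) (b : E ψ) :
      (b : B) • (s ψ a : M) ∈ LinearMap.range Θ := by
    classical
    refine ⟨Pi.single ψ (a ⊗ₜ b), ?_⟩
    simp only [Θ, LinearMap.sum_apply, LinearMap.comp_apply, LinearMap.proj_apply]
    rw [Finset.sum_eq_single ψ (fun φ _ h => by rw [Pi.single_eq_of_ne h, map_zero]) (by simp),
      Pi.single_eq_same]
    simp
  have hNΘ (m : M) (hm : m ∈ N) (b : B) : isotypicProj τ χ ((e * b) • m) ∈ LinearMap.range Θ := by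
    induction hm using Submodule.span_induction generalizing b with
    | mem m hm =>
      obtain ⟨ψ, a, rfl⟩ := Set.mem_iUnion.mp hm
      rw [isotypicProj_smul hτ (div_mul_cancel χ ψ) _ (s ψ a).2]
      refine hΘ ψ a ⟨_, isotypicProj_mem _ _, isotypicProj_mem_of_invariant _
        (apply_mem_idempotentPart (τ := toRep ρ) (fun h => map_mul (ρ h)) he') ?_⟩
      exact smul_mem_idempotentPart he b
    | zero => simp
    | add x y _ _ hx hy => simpa only [smul_add, map_add] using add_mem (hx b) (hy b)
    | smul c x _ hx => simpa only [smul_smul, mul_assoc] using hx (b * c)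
  have hle : isotypic τ χ ⊓ idempotentPart k M e ≤ LinearMap.range Θ := by
    rintro m ⟨hm, hme⟩
    obtain ⟨x, hx, y, hy, rfl⟩ := Submodule.mem_sup.mp (hN n ▸ Submodule.mem_top : m ∈ _)
    have hey : e • y = 0 := by
      clear hm hme
      induction hy using Submodule.smul_induction_on' with
      | smul r hr z _ => rw [smul_smul, hn r hr, zero_smul]
      | add a _ b _ ha hb => rw [smul_add, ha, hb, add_zero]
    rw [SetLike.mem_coe, mem_idempotentPart, smul_add, hey, add_zero] at hme
    have := hNΘ x hx 1
    rwa [mul_one, hme, isotypicProj_of_mem hH hm] at this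
  calc _ ≤ Module.finrank k (LinearMap.range Θ) := Submodule.finrank_mono hle
    _ ≤ Module.finrank k (∀ ψ, isotypic τ' ψ ⊗[k] E ψ) := Θ.finrank_range_le
    _ = _ := by simp only [Module.finrank_pi_fintype, Module.finrank_tensorProduct, E]

variable (b : Module.Basis (Fin (Module.finrank k M')) B M)
  (hIρ : ∀ h, ∀ x ∈ I, ρ h x ∈ I) (hI : ∀ h ≠ 1, I ≤ displacementIdeal (ρ h))
include b hIρ hI

/-- A finite free module `M` with a semilinear action of a finite commutative group, over an
algebra `B` on which the group acts freely outside the zero locus of `I`, has the character of the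
tensor product of `M ⧸ I M` and `B`. -/
theorem finrank_isotypic_eq_sum (χ : H →* kˣ) :
    Module.finrank k (isotypic τ χ) = ∑ ψ : H →* kˣ, Module.finrank k (isotypic τ' ψ) *
      Module.finrank k (isotypic (toRep ρ) (χ / ψ)) := by
  have : IsArtinianRing B := IsArtinianRing.of_finite k B
  obtain ⟨n, hn⟩ := IsArtinian.monotone_stabilizes (R := B) (M := B)
    ⟨fun n => OrderDual.toDual (I ^ n), fun _ _ h => Ideal.pow_le_pow_right h⟩
  replace hn (m : ℕ) (h : n ≤ m) : I ^ n = I ^ m := hn m h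
  -- The exponent is `n + 1` so that the power is contained in `I` even when `n = 0`.
  have hidem : IsIdempotentElem (I ^ (n + 1)) := by
    rw [IsIdempotentElem, ← pow_add, ← hn (n + 1 + (n + 1)) (by omega), ← hn (n + 1) (by omega)]
  obtain ⟨u, hu, hspan⟩ := (Ideal.isIdempotentElem_iff_of_fg _ (IsNoetherian.noetherian _)).mp hidem
  have huI : u ∈ I ^ (n + 1) := hspan ▸ Submodule.mem_span_singleton_self u
  have hmul (x : B) (hx : x ∈ I ^ (n + 1)) : x * u = x := by
    rw [hspan] at hx
    obtain ⟨c, rfl⟩ := Submodule.mem_span_singleton.mp hx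
    rw [smul_eq_mul, mul_assoc, hu.eq]
  have hpow (h : H) (x : B) (hx : x ∈ I ^ (n + 1)) : ρ h x ∈ I ^ (n + 1) := by
    have hle : I.map (ρ h) ≤ I := Ideal.map_le_iff_le_comap.mpr fun x hx => hIρ h x hx
    have := Ideal.mem_map_of_mem (ρ h) hx
    rw [Ideal.map_pow] at this
    exact Ideal.pow_right_mono hle _ this
  -- Both `u` and `ρ h u` act as the identity on the `H`-stable ideal `I ^ (n + 1)`, so they
  -- coincide.
  have hu' (h : H) : ρ h u = u := by
    have h1 := hmul _ (hpow h u huI)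
    have h2 := congrArg (ρ h) (hmul _ (hpow h⁻¹ u huI))
    have h3 : ρ h (ρ h⁻¹ u) = u := by
      rw [← AlgHom.mul_apply, ← map_mul, mul_inv_cancel, map_one, AlgHom.one_apply]
    rw [map_mul, h3, mul_comm] at h2
    rw [← h1, h2]
  have humem (h : H) (hh : h ≠ 1) : u ∈ displacementIdeal (ρ h) :=
    hI h hh (Ideal.pow_le_self n.succ_ne_zero huI)
  have he := hu.one_sub
  have he' (h : H) : ρ h (1 - u) = 1 - u := by rw [map_sub, map_one, hu']
  have hρ (h : H) (b c : B) : toRep ρ h (b • c) = ρ h b • toRep ρ h c := map_mul (ρ h) b c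
  have htop : ∑ ψ, Module.finrank k (isotypic τ' ψ) = Module.finrank k M' := by
    rw [← finrank_top k M', ← sum_finrank_isotypic_inf (ρ := τ') hH (W := ⊤) (fun _ _ _ => trivial)]
    exact Finset.sum_congr rfl fun ψ _ => by rw [inf_top_eq]
  -- Multiplied by the number of characters, both sides become dim `M'` times the dimension of `u
  -- B`.
  have hfree (χ : H →* kˣ) : Module.finrank k ↥(isotypic τ χ ⊓ idempotentPart k M u) =
      ∑ ψ : H →* kˣ, Module.finrank k (isotypic τ' ψ) *
        Module.finrank k ↥(isotypic (toRep ρ) (χ / ψ) ⊓ idempotentPart k B u) := by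
    simp only [← finrank_isotypic_inf_idempotentPart_eq hρ hu hu' humem hH (χ / _)]
    rw [← Finset.sum_mul, htop]
    refine Nat.eq_of_mul_eq_mul_left (Fintype.card_pos (α := H →* kˣ)) ?_
    rw [card_mul_finrank_isotypic_inf_idempotentPart hτ hu hu' humem hH, mul_left_comm,
      card_mul_finrank_isotypic_inf_idempotentPart hρ hu hu' humem hH, finrank_idempotentPart b,
      Fintype.card_fin]
  -- The inequality holds for each character and the sums over all characters agree, so every
  -- inequality is an equality.
  have hlocal : Module.finrank k ↥(isotypic τ χ ⊓ idempotentPart k M (1 - u)) =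
      ∑ ψ : H →* kˣ, Module.finrank k (isotypic τ' ψ) *
        Module.finrank k ↥(isotypic (toRep ρ) (χ / ψ) ⊓ idempotentPart k B (1 - u)) := by
    refine (Finset.sum_eq_sum_iff_of_le fun χ _ => finrank_isotypic_inf_idempotentPart_le hH hτ π
      hπτ hπ hker he he' (n := n + 1) (fun x hx => ?_) χ).mp ?_ χ (Finset.mem_univ χ)
    · rw [sub_mul, one_mul, mul_comm, hmul x hx, sub_self]
    · rw [sum_finrank_isotypic_inf hH (apply_mem_idempotentPart hτ he'), finrank_idempotentPart b,
        Fintype.card_fin, ← htop, Finset.sum_comm, Finset.sum_mul]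
      refine Finset.sum_congr rfl fun ψ _ => ?_
      rw [← Finset.mul_sum, ← sum_finrank_isotypic_inf hH (apply_mem_idempotentPart hρ he')]
      congr 1
      exact (Fintype.sum_equiv (Equiv.divRight ψ) _ _ fun _ => rfl).symm
  rw [finrank_isotypic_eq_add hτ hu hu', hlocal, hfree, ← Finset.sum_add_distrib]
  refine Finset.sum_congr rfl fun ψ _ => ?_
  rw [← mul_add, ← finrank_isotypic_eq_add hρ hu hu']

end Convolution

/-! ### Points of an affine scheme as ring homomorphisms. -/

section Affine

variable {X : Scheme.{u}} [IsAffine X] {R : CommRingCat.{u}}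

lemma specMap_appTop_isoSpec_inv (t : Spec R ⟶ X) :
    Spec.map (t.appTop ≫ (Scheme.ΓSpecIso R).hom) ≫ X.isoSpec.inv = t := by
  rw [Spec.map_comp, Category.assoc, Scheme.isoSpec_inv_naturality, Scheme.isoSpec_Spec_inv,
    ← Spec.map_comp_assoc, Iso.inv_hom_id, Spec.map_id, Category.id_comp]

lemma appTop_specMap_isoSpec_inv (φ : Γ(X, ⊤) ⟶ R) :
    (Spec.map φ ≫ X.isoSpec.inv).appTop ≫ (Scheme.ΓSpecIso R).hom = φ := by
  have h : X.isoSpec.inv.appTop ≫ (Scheme.ΓSpecIso Γ(X, ⊤)).hom = 𝟙 _ := by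
    rw [← Scheme.toSpecΓ_appTop, ← Scheme.Hom.comp_appTop, Scheme.toSpecΓ_isoSpec_inv]
    rfl
  rw [Scheme.Hom.comp_appTop, Category.assoc, Scheme.ΓSpecIso_naturality, reassoc_of% h]

end Affine

section SpecOver

variable {k : Type u} [CommRing k]

variable (k) in
/-- The spectrum of a `k`-algebra as a scheme over `Spec k`. -/
abbrev specOver (D : Type u) [CommRing D] [Algebra k D] : Over (Spec (CommRingCat.of k)) :=
  Over.mk (Spec.map (CommRingCat.ofHom (algebraMap k D)))

variable {D E : Type u} [CommRing D] [Algebra k D] [CommRing E] [Algebra k E]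

/-- The morphism of spectra induced by a morphism of `k`-algebras. -/
def specOverMap (φ : D →ₐ[k] E) : specOver k E ⟶ specOver k D :=
  Over.homMk (Spec.map (CommRingCat.ofHom φ.toRingHom)) <| by
    dsimp only [Over.mk_hom]
    rw [← Spec.map_comp, ← CommRingCat.ofHom_comp]
    exact congrArg (fun f => Spec.map (CommRingCat.ofHom f)) φ.comp_algebraMap

@[simp]
lemma specOverMap_left (φ : D →ₐ[k] E) :
    (specOverMap φ).left = Spec.map (CommRingCat.ofHom φ.toRingHom) := rfl

end SpecOver

namespace VectorSpaceScheme

variable {F : Type v} [Field F] {k : Type u} [Field k]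
  (G : VectorSpaceScheme F (Spec (CommRingCat.of k)))

lemma isFinite_hom : IsFinite G.scheme.hom := by
  obtain ⟨X, ⟨h⟩, hX, -, -⟩ := G.property
  let e : G.scheme ≅ X := G.representableBy.uniqueUpToIso h
  have : IsIso e.hom.left := inferInstanceAs (IsIso ((Over.forget _).map e.hom))
  rw [← Over.w e.hom]
  exact MorphismProperty.comp_mem @IsFinite _ _ inferInstance hX

instance : IsAffine G.scheme.left :=
  haveI := G.isFinite_hom
  isAffine_of_isAffineHom G.scheme.hom

lemma algebraMap_coordinateRing : algebraMap k G.CoordinateRing =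
    ((Scheme.ΓSpecIso (CommRingCat.of k)).inv ≫ G.scheme.hom.appTop).hom := rfl

instance : Module.Finite k G.CoordinateRing := by
  have := G.isFinite_hom
  have h : (G.scheme.hom.appTop).hom.Finite := G.scheme.hom.finite_appTop
  rw [← RingHom.finite_algebraMap, algebraMap_coordinateRing, CommRingCat.hom_comp]
  refine h.comp (RingHom.Finite.of_surjective _ ?_)
  exact (Scheme.ΓSpecIso (CommRingCat.of k)).symm.commRingCatIsoToRingEquiv.surjective

variable (D : Type u) [CommRing D] [Algebra k D]

/-- The `F`-vector space of points of `G` with values in a `k`-algebra. -/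
abbrev points : Type u := G.obj.obj (op (specOver k D))

variable {D} {E : Type u} [CommRing E] [Algebra k E]

/-- The functoriality of points. -/
def pointsMap (φ : D →ₐ[k] E) : G.points D →ₗ[F] G.points E := (G.obj.map (specOverMap φ).op).hom

/-- The morphism on functions given by a morphism into `G` from an affine scheme. -/
def algHomOfHom (t : specOver k D ⟶ G.scheme) : G.CoordinateRing →ₐ[k] D where
  __ := (t.left.appTop ≫ (Scheme.ΓSpecIso (CommRingCat.of D)).hom).hom
  commutes' r := by
    have h := congrArg Scheme.Hom.appTop (Over.w t)
    rw [Scheme.Hom.comp_appTop] at h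
    have h2 : (Scheme.ΓSpecIso (CommRingCat.of k)).inv ≫ G.scheme.hom.appTop ≫ t.left.appTop ≫
        (Scheme.ΓSpecIso (CommRingCat.of D)).hom = CommRingCat.ofHom (algebraMap k D) := by
      dsimp only [Over.mk_hom] at h
      rw [reassoc_of% h, Scheme.ΓSpecIso_naturality, Iso.inv_hom_id_assoc]
    exact ConcreteCategory.congr_hom h2 r

/-- A morphism of algebras out of `A`, as a morphism of rings of global functions. -/
def homOfCoordinateRing (φ : G.CoordinateRing →ₐ[k] D) :
    Γ(G.scheme.left, ⊤) ⟶ CommRingCat.of D :=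
  CommRingCat.ofHom φ.toRingHom

/-- The morphism into `G` given by a morphism on functions. -/
def homOfAlgHom (φ : G.CoordinateRing →ₐ[k] D) : specOver k D ⟶ G.scheme :=
  Over.homMk (Spec.map (G.homOfCoordinateRing φ) ≫ G.scheme.left.isoSpec.inv) <| by
    have h : (Scheme.ΓSpecIso (CommRingCat.of k)).inv ≫ G.scheme.hom.appTop ≫
        G.homOfCoordinateRing φ = CommRingCat.ofHom (algebraMap k D) :=
      CommRingCat.hom_ext φ.comp_algebraMap
    rw [Category.assoc, ← Scheme.isoSpec_inv_naturality, Scheme.isoSpec_Spec_inv, ← Spec.map_comp,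
      ← Spec.map_comp, Category.assoc, h]
    rfl

/-- The points of `G = Spec A` with values in `D` are the morphisms of `k`-algebras `A → D`. -/
def pointsEquiv : G.points D ≃ (G.CoordinateRing →ₐ[k] D) :=
  G.representableBy.homEquiv.symm.trans
    { toFun := G.algHomOfHom
      invFun := G.homOfAlgHom
      left_inv := fun t => Over.OverMorphism.ext (specMap_appTop_isoSpec_inv t.left)
      right_inv := fun φ => AlgHom.ext fun a =>
        ConcreteCategory.congr_hom (appTop_specMap_isoSpec_inv (G.homOfCoordinateRing φ)) a }

lemma pointsEquiv_map (φ : D →ₐ[k] E) (x : G.points D) :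
    G.pointsEquiv (G.pointsMap φ x) = φ.comp (G.pointsEquiv x) := by
  obtain ⟨t, rfl⟩ := G.representableBy.homEquiv.surjective x
  have h : G.pointsMap φ (G.representableBy.homEquiv t) =
      G.representableBy.homEquiv (specOverMap φ ≫ t) :=
    (G.representableBy.homEquiv_comp (specOverMap φ) t).symm
  rw [h]
  simp only [pointsEquiv, Equiv.trans_apply, Equiv.symm_apply_apply, Equiv.coe_fn_mk]
  have h2 : (specOverMap φ ≫ t).left.appTop ≫ (Scheme.ΓSpecIso (CommRingCat.of E)).hom =
      (t.left.appTop ≫ (Scheme.ΓSpecIso (CommRingCat.of D)).hom) ≫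
        CommRingCat.ofHom φ.toRingHom := by
    rw [Over.comp_left, Scheme.Hom.comp_appTop, Category.assoc, Category.assoc, specOverMap_left]
    erw [Scheme.ΓSpecIso_naturality]
  exact AlgHom.ext fun a => ConcreteCategory.congr_hom h2 a

lemma pointsEquiv_smul (c : F) (x : G.points D) :
    G.pointsEquiv (c • x) = (G.pointsEquiv x).comp (G.coaction c) := by
  obtain ⟨t, rfl⟩ := G.representableBy.homEquiv.surjective x
  have h : c • (G.representableBy.homEquiv t : G.points D) =
      G.representableBy.homEquiv (t ≫ G.smulHom c) := by
    have h1 := G.representableBy.homEquiv_comp t (𝟙 _)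
    rw [Category.comp_id] at h1
    rw [G.representableBy.homEquiv_comp, smulHom, Equiv.apply_symm_apply, h1]
    exact (map_smul (G.obj.map t.op).hom c G.universalPoint).symm
  rw [h]
  simp only [pointsEquiv, Equiv.trans_apply, Equiv.symm_apply_apply, Equiv.coe_fn_mk]
  have h2 : (t ≫ G.smulHom c).left.appTop ≫ (Scheme.ΓSpecIso (CommRingCat.of D)).hom =
      (G.smulHom c).left.appTop ≫ t.left.appTop ≫ (Scheme.ΓSpecIso (CommRingCat.of D)).hom := by
    rw [Over.comp_left, Scheme.Hom.comp_appTop, Category.assoc]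
  exact AlgHom.ext fun a => ConcreteCategory.congr_hom h2 a

end VectorSpaceScheme

/-! ### Yoneda: linear structure and morphisms read on coordinate rings. -/

namespace VectorSpaceScheme

variable {F : Type v} [Field F] {k : Type u} [Field k]
  {G G' G'' : VectorSpaceScheme F (Spec (CommRingCat.of k))}
  {D : Type u} [CommRing D] [Algebra k D] {E : Type u} [CommRing E] [Algebra k E]

lemma pointsMap_symm (φ : D →ₐ[k] E) (ψ : G.CoordinateRing →ₐ[k] D) :
    G.pointsMap φ (G.pointsEquiv.symm ψ) = G.pointsEquiv.symm (φ.comp ψ) := by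
  rw [Equiv.eq_symm_apply, pointsEquiv_map, Equiv.apply_symm_apply]

/-- A morphism of vector space schemes on points. -/
def pointsHom (f : G' ⟶ G) (D : Type u) [CommRing D] [Algebra k D] : G'.points D →ₗ[F] G.points D :=
  (f.hom.app (op (specOver k D))).hom

lemma pointsHom_pointsMap (f : G' ⟶ G) (φ : D →ₐ[k] E) (x : G'.points D) :
    pointsHom f E (G'.pointsMap φ x) = G.pointsMap φ (pointsHom f D x) :=
  ConcreteCategory.congr_hom (f.hom.naturality (specOverMap φ).op) x

/-- The morphism of coordinate rings given by a morphism of vector space schemes. -/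
def comorphism (f : G' ⟶ G) : G.CoordinateRing →ₐ[k] G'.CoordinateRing :=
  G.pointsEquiv (pointsHom f _ (G'.pointsEquiv.symm (AlgHom.id k _)))

lemma pointsEquiv_pointsHom (f : G' ⟶ G) (x : G'.points D) :
    G.pointsEquiv (pointsHom f D x) = (G'.pointsEquiv x).comp (comorphism f) := by
  rw [comorphism, ← pointsEquiv_map, ← pointsHom_pointsMap, pointsMap_symm, AlgHom.comp_id,
    Equiv.symm_apply_apply]

lemma pointsHom_symm (f : G' ⟶ G) (φ : G'.CoordinateRing →ₐ[k] D) :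
    pointsHom f D (G'.pointsEquiv.symm φ) = G.pointsEquiv.symm (φ.comp (comorphism f)) := by
  rw [Equiv.eq_symm_apply, pointsEquiv_pointsHom, Equiv.apply_symm_apply]

lemma smul_symm (c : F) (φ : G.CoordinateRing →ₐ[k] D) :
    c • G.pointsEquiv.symm φ = G.pointsEquiv.symm (φ.comp (G.coaction c)) := by
  rw [Equiv.eq_symm_apply, pointsEquiv_smul, Equiv.apply_symm_apply]

variable (G) in
/-- The zero section of `G`, on functions. -/
def counit : G.CoordinateRing →ₐ[k] k := G.pointsEquiv 0

variable (G D) in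
lemma symm_ofId_comp_counit : G.pointsEquiv.symm ((Algebra.ofId k D).comp G.counit) = 0 := by
  rw [← pointsMap_symm, counit, Equiv.symm_apply_apply, map_zero]

lemma coaction_one : G.coaction 1 = AlgHom.id k _ := by
  have h := smul_symm (1 : F) (AlgHom.id k G.CoordinateRing)
  rw [one_smul, AlgHom.id_comp] at h
  exact (G.pointsEquiv.symm.injective h).symm

lemma coaction_mul (c d : F) : G.coaction (c * d) = (G.coaction c).comp (G.coaction d) := by
  have h := smul_symm (d * c) (AlgHom.id k G.CoordinateRing)
  rw [mul_smul, smul_symm, smul_symm, AlgHom.id_comp, AlgHom.id_comp, mul_comm d c] at h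
  exact (G.pointsEquiv.symm.injective h).symm

variable (G) in
/-- The action of `Fˣ` on the coordinate ring. -/
def coactionHom : Fˣ →* (G.CoordinateRing →ₐ[k] G.CoordinateRing) where
  toFun c := G.coaction c
  map_one' := coaction_one
  map_mul' c d := by rw [Units.val_mul, coaction_mul]; rfl

lemma isotypicComponent_eq (χ : Fˣ →* kˣ) :
    G.isotypicComponent χ = isotypic (toRep G.coactionHom) χ := rfl

lemma comorphism_coaction (f : G' ⟶ G) (c : F) (a : G.CoordinateRing) :
    comorphism f (G.coaction c a) = G'.coaction c (comorphism f a) := by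
  have h := map_smul (pointsHom f _) c (G'.pointsEquiv.symm (AlgHom.id k G'.CoordinateRing))
  rw [pointsHom_symm, smul_symm, smul_symm, pointsHom_symm, AlgHom.id_comp, AlgHom.id_comp] at h
  exact (DFunLike.congr_fun (G.pointsEquiv.symm.injective h) a).symm

lemma counit_coaction (c : F) (a : G.CoordinateRing) : G.counit (G.coaction c a) = G.counit a := by
  have h := smul_zero (A := G.points k) c
  rw [← G.pointsEquiv.symm_apply_apply 0, smul_symm] at h
  exact DFunLike.congr_fun (G.pointsEquiv.symm.injective h) a

/-- The quotient map by `J` is a point `x` with `c • x = x`. As `c - 1` is invertible in `F`, `x =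
0`, so the quotient map factors through the counit. -/
lemma ker_counit_le_displacementIdeal {c : Fˣ} (hc : c ≠ 1) :
    RingHom.ker G.counit ≤ displacementIdeal (G.coactionHom c) := by
  set J := displacementIdeal (G.coactionHom c)
  let x := G.pointsEquiv.symm (Ideal.Quotient.mkₐ k J)
  have hx : (c : F) • x = x := by
    rw [smul_symm]
    refine congrArg _ (AlgHom.ext fun a => ?_)
    exact Ideal.Quotient.mk_eq_mk_iff_sub_mem _ _ |>.mpr (Ideal.subset_span ⟨a, rfl⟩)
  have hx0 : x = 0 := by
    have h : ((c : F) - 1) • x = 0 := by rw [sub_smul, one_smul, hx, sub_self]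
    exact (smul_eq_zero.mp h).resolve_left fun h => hc (Units.ext (sub_eq_zero.mp h))
  rw [← symm_ofId_comp_counit] at hx0
  intro a ha
  have h := DFunLike.congr_fun (G.pointsEquiv.symm.injective hx0) a
  rw [AlgHom.comp_apply, show G.counit a = 0 from ha, map_zero] at h
  exact Ideal.Quotient.eq_zero_iff_mem.mp h

end VectorSpaceScheme

/-! ### The kernel `G'` as the zero fibre of `G → G''`. -/

namespace IsShortExact

open VectorSpaceScheme

variable {F : Type v} [Field F] {k : Type u} [Field k]
  {G G' G'' : VectorSpaceScheme F (Spec (CommRingCat.of k))} {f : G' ⟶ G} {g : G ⟶ G''}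
  (hfg : IsShortExact f g)
  {D : Type u} [CommRing D] [Algebra k D] {E : Type u} [CommRing E] [Algebra k E]
include hfg

lemma pointsHom_injective : Function.Injective (pointsHom f D) := hfg.injective _

lemma pointsHom_exact : Function.Exact (pointsHom f D) (pointsHom g D) := hfg.exact _

lemma comorphism_comp_comorphism :
    (comorphism f).comp (comorphism g) = (Algebra.ofId k _).comp G''.counit := by
  apply G''.pointsEquiv.symm.injective
  rw [← pointsHom_symm, symm_ofId_comp_counit,
    ← (comorphism f).id_comp, ← pointsHom_symm, hfg.pointsHom_exact.apply_apply_eq_zero]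

/-- The zero fibre is a tautological point of `G` that `g` sends to zero; exactness lifts it to
`G'`. -/
lemma exists_comp_comorphism_eq_mk :
    ∃ θ : G'.CoordinateRing →ₐ[k]
        G.CoordinateRing ⧸ (RingHom.ker G''.counit).map (comorphism g),
      θ.comp (comorphism f) = Ideal.Quotient.mkₐ k _ := by
  set J := (RingHom.ker G''.counit).map (comorphism g)
  have hg : pointsHom g _ (G.pointsEquiv.symm (Ideal.Quotient.mkₐ k J)) = 0 := by
    rw [pointsHom_symm, ← symm_ofId_comp_counit]
    refine congrArg _ (AlgHom.ext fun b => ?_)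
    have hb : b - algebraMap k _ (G''.counit b) ∈ RingHom.ker G''.counit := by
      rw [RingHom.mem_ker, map_sub, AlgHom.commutes, Algebra.algebraMap_self_apply, sub_self]
    have h := Ideal.Quotient.eq_zero_iff_mem.mpr (Ideal.mem_map_of_mem (comorphism g) hb)
    rw [map_sub, map_sub, sub_eq_zero, AlgHom.commutes] at h
    exact h
  obtain ⟨x, hx⟩ := (hfg.pointsHom_exact _).mp hg
  refine ⟨G'.pointsEquiv x, ?_⟩
  rw [← pointsEquiv_pointsHom, hx, Equiv.apply_symm_apply]

lemma mem_of_comorphism_eq_zero {a : G.CoordinateRing} (ha : comorphism f a = 0) :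
    a ∈ (RingHom.ker G''.counit).map (comorphism g) := by
  obtain ⟨θ, hθ⟩ := hfg.exists_comp_comorphism_eq_mk
  have h := DFunLike.congr_fun hθ a
  rw [AlgHom.comp_apply, ha, map_zero] at h
  exact Ideal.Quotient.eq_zero_iff_mem.mp h.symm

/-- The map `θ` is a section of the map `π` induced on the quotient by `comorphism f`: injectivity
of `f` on points forces `π ∘ θ = id`. -/
lemma comorphism_surjective : Function.Surjective (comorphism f) := by
  obtain ⟨θ, hθ⟩ := hfg.exists_comp_comorphism_eq_mk
  have hle : (RingHom.ker G''.counit).map (comorphism g) ≤ RingHom.ker (comorphism f) := by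
    refine Ideal.map_le_iff_le_comap.mpr fun b hb => ?_
    have h := DFunLike.congr_fun hfg.comorphism_comp_comorphism b
    rw [AlgHom.comp_apply, AlgHom.comp_apply, show G''.counit b = 0 from hb, map_zero] at h
    exact h
  let π := Ideal.Quotient.liftₐ _ (comorphism f) fun a ha => hle ha
  have hπ : π.comp (Ideal.Quotient.mkₐ k _) = comorphism f := Ideal.Quotient.liftₐ_comp _ _ _
  have hid : π.comp θ = AlgHom.id k _ := by
    apply G'.pointsEquiv.symm.injective
    apply hfg.pointsHom_injective
    rw [pointsHom_symm, pointsHom_symm, AlgHom.comp_assoc, hθ, hπ, AlgHom.id_comp]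
  intro a
  obtain ⟨b, hb⟩ := Ideal.Quotient.mk_surjective (θ a)
  refine ⟨b, ?_⟩
  rw [← hπ, AlgHom.comp_apply, Ideal.Quotient.mkₐ_eq_mk, hb]
  exact DFunLike.congr_fun hid a

end IsShortExact

/-! ### Faithfully flat descent of freeness. -/

section Descent

variable {B C M : Type*} [CommRing B] [CommRing C] [Algebra B C] [Module.FaithfullyFlat B C]
  [AddCommGroup M] [Module B M]

/-- A finite module over a semilocal ring that becomes free of rank `n` after a faithfully flat
base change is free of rank `n`. -/
lemma nonempty_basis_of_faithfullyFlat [Finite (MaximalSpectrum B)] [Module.Finite B M] {n : ℕ}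
    (b : Module.Basis (Fin n) C (C ⊗[B] M)) : Nonempty (Module.Basis (Fin n) B M) := by
  have : Module.Free C (C ⊗[B] M) := .of_basis b
  have : Module.Flat B M := .of_flat_tensorProduct B M C
  refine Module.nonempty_basis_of_flat_of_finrank_eq B M n fun P => ?_
  obtain ⟨q, hq⟩ := PrimeSpectrum.comap_surjective_of_faithfullyFlat (B := C)
    ⟨P.asIdeal, P.isMaximal.isPrime⟩
  have : Nontrivial C := ⟨0, 1, fun h => q.isPrime.ne_top ((Ideal.eq_top_iff_one _).mpr
    (h ▸ q.asIdeal.zero_mem))⟩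
  -- Fibre ranks are unchanged by base change, so the rank at `P` is the rank `n` at a prime `q`
  -- above it.
  have h1 := Module.rankAtStalk_baseChange (R := B) (M := M) q
  rw [hq, Module.rankAtStalk_eq_finrank_of_free, Module.finrank_eq_card_basis b,
    Fintype.card_fin, Module.rankAtStalk_eq] at h1
  have : P.asIdeal.IsMaximal := P.isMaximal
  let := Ideal.Quotient.field P.asIdeal
  have e := Module.finrank_baseChange (R := P.asIdeal.ResidueField) (S := B ⧸ P.asIdeal)
    (M' := (B ⧸ P.asIdeal) ⊗[B] M)
  rw [← e, (TensorProduct.AlgebraTensorModule.cancelBaseChange B (B ⧸ P.asIdeal)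
    P.asIdeal.ResidueField P.asIdeal.ResidueField M).finrank_eq]
  simpa using h1.symm

end Descent

/-! ### The torsor `G → G''` and freeness of its coordinate ring. -/

namespace IsShortExact

open VectorSpaceScheme

variable {F : Type v} [Field F] {k : Type u} [Field k]
  {G G' G'' : VectorSpaceScheme F (Spec (CommRingCat.of k))} {f : G' ⟶ G} {g : G ⟶ G''}
  (hfg : IsShortExact f g)
include hfg

/-- A local section of an extension trivializes it. -/
lemma nonempty_algEquiv_of_section [Algebra G''.CoordinateRing G.CoordinateRing]
    [IsScalarTower k G''.CoordinateRing G.CoordinateRing]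
    (hg : ∀ b, algebraMap G''.CoordinateRing G.CoordinateRing b = comorphism g b)
    (C : Type u) [CommRing C] [Algebra k C] [Algebra G''.CoordinateRing C]
    [IsScalarTower k G''.CoordinateRing C] (s : G.CoordinateRing →ₐ[G''.CoordinateRing] C) :
    Nonempty (C ⊗[G''.CoordinateRing] G.CoordinateRing ≃ₐ[C] C ⊗[k] G'.CoordinateRing) := by
  let s' : G.CoordinateRing →ₐ[k] C := s.restrictScalars k
  let D := C ⊗[k] G'.CoordinateRing
  let E := C ⊗[G''.CoordinateRing] G.CoordinateRing
  let ιD : C →ₐ[k] D := Algebra.TensorProduct.includeLeft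
  let ιE : C →ₐ[k] E := Algebra.TensorProduct.includeLeft
  let jD : G'.CoordinateRing →ₐ[k] D := Algebra.TensorProduct.includeRight
  let jE : G.CoordinateRing →ₐ[k] E :=
    (Algebra.TensorProduct.includeRight :
      G.CoordinateRing →ₐ[G''.CoordinateRing] E).restrictScalars k
  have hs : s'.comp (comorphism g) = IsScalarTower.toAlgHom k G''.CoordinateRing C :=
    AlgHom.ext fun b => (congrArg s (hg b).symm).trans (s.commutes b)
  have hjE : jE.comp (comorphism g) = ιE.comp (s'.comp (comorphism g)) := by
    rw [hs]
    refine AlgHom.ext fun b => ?_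
    change (1 : C) ⊗ₜ[G''.CoordinateRing] comorphism g b = algebraMap _ C b ⊗ₜ 1
    rw [← hg, Algebra.algebraMap_eq_smul_one, Algebra.algebraMap_eq_smul_one,
      TensorProduct.tmul_smul, TensorProduct.smul_tmul']
  -- The trivialization is `x ↦ s + x` on `G'`, with inverse `y ↦ y - s`; `p` and `q` are these
  -- expressions at the universal points.
  let sD := G.pointsEquiv.symm (ιD.comp s')
  let p := sD + pointsHom f D (G'.pointsEquiv.symm jD)
  let sE := G.pointsEquiv.symm (ιE.comp s')
  let q := G.pointsEquiv.symm jE - sE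
  have hp : pointsHom g D p = pointsHom g D sD := by
    rw [map_add, hfg.pointsHom_exact.apply_apply_eq_zero, add_zero]
  have hq : pointsHom g E q = 0 := by
    rw [map_sub, pointsHom_symm, pointsHom_symm, hjE, AlgHom.comp_assoc, sub_self]
  obtain ⟨q', hq'⟩ := (hfg.pointsHom_exact _).mp hq
  have hpB (b : G''.CoordinateRing) : G.pointsEquiv p (comorphism g b) =
      ιD (algebraMap G''.CoordinateRing C b) := by
    have h := congrArg G''.pointsEquiv hp
    rw [pointsEquiv_pointsHom, pointsEquiv_pointsHom, Equiv.apply_symm_apply, AlgHom.comp_assoc,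
      hs] at h
    exact DFunLike.congr_fun h b
  let pB : G.CoordinateRing →ₐ[G''.CoordinateRing] D :=
    { G.pointsEquiv p with commutes' := fun b => by rw [hg]; exact hpB b }
  let α : E →ₐ[C] D := Algebra.TensorProduct.lift (Algebra.ofId C D) pB fun _ _ => .all _ _
  let β : D →ₐ[C] E := Algebra.TensorProduct.lift (Algebra.ofId C E) (G'.pointsEquiv q')
    fun _ _ => .all _ _
  have hαι : (α.restrictScalars k).comp ιE = ιD := AlgHom.ext fun c => α.commutes c
  have hβι : (β.restrictScalars k).comp ιD = ιE := AlgHom.ext fun c => β.commutes c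
  have hαj : (α.restrictScalars k).comp jE = G.pointsEquiv p := AlgHom.ext fun a => by
    have h := Algebra.TensorProduct.lift_tmul (Algebra.ofId C D) pB (fun _ _ => .all _ _) 1 a
    rw [map_one, one_mul] at h
    exact h
  have hβj : (β.restrictScalars k).comp jD = G'.pointsEquiv q' := AlgHom.ext fun a => by
    have h := Algebra.TensorProduct.lift_tmul (Algebra.ofId C E) (G'.pointsEquiv q')
      (fun _ _ => .all _ _) 1 a
    rw [map_one, one_mul] at h
    exact h
  -- On points this is `s + (y - s) = y`, and `hαq` below is `(s + x) - s = x`.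
  have hβp : (β.restrictScalars k).comp (G.pointsEquiv p) = jE := by
    apply G.pointsEquiv.symm.injective
    rw [← pointsMap_symm, Equiv.symm_apply_apply, map_add, pointsMap_symm, ← pointsHom_pointsMap,
      pointsMap_symm, hβj, Equiv.symm_apply_apply, hq', ← AlgHom.comp_assoc, hβι]
    exact add_sub_cancel _ _
  have hαq : (α.restrictScalars k).comp (G'.pointsEquiv q') = jD := by
    apply G'.pointsEquiv.symm.injective
    apply hfg.pointsHom_injective
    rw [← pointsMap_symm, Equiv.symm_apply_apply, pointsHom_pointsMap, hq', map_sub, pointsMap_symm,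
      pointsMap_symm, hαj, Equiv.symm_apply_apply, ← AlgHom.comp_assoc, hαι]
    exact add_sub_cancel_left _ _
  refine ⟨AlgEquiv.ofAlgHom α β ?_ ?_⟩
  · refine Algebra.TensorProduct.ext (by ext) (AlgHom.ext fun a => ?_)
    exact (congrArg α (DFunLike.congr_fun hβj a)).trans (DFunLike.congr_fun hαq a)
  · refine Algebra.TensorProduct.ext (by ext) (AlgHom.ext fun a => ?_)
    exact (congrArg β (DFunLike.congr_fun hαj a)).trans (DFunLike.congr_fun hβp a)

end IsShortExact

/-- Members of a covering sieve for the fppf topology that are spectra of rings, flat over the base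
and contain a given point in their image. -/
lemma exists_flat_spec_of_mem_fppfTopology {X : Scheme.{u}} {R : Sieve X}
    (hR : R ∈ Scheme.fppfTopology X) (x : X) :
    ∃ (C : CommRingCat.{u}) (t : Spec C ⟶ X) (z : Spec C), R t ∧ Flat t ∧ t z = x := by
  have : Scheme.fppfPrecoverage.{u}.HasIsos :=
    ⟨fun f _ => f.singleton_mem_fppfPrecoverage⟩
  obtain ⟨P, ⟨hP1, hP2⟩, hle⟩ :=
    Precoverage.mem_toGrothendieck_iff_of_isStableUnderComposition.mp hR
  obtain ⟨T, h, hh, y, hy⟩ := (Presieve.mem_comap_jointlySurjectivePrecoverage_iff _).mp hP1 x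
  obtain ⟨C, i, hi, z, hz⟩ := Scheme.exists_Spec_apply_eq y
  have : Flat h := (hP2 hh).1
  refine ⟨C, i ≫ h, z, R.downward_closed (hle _ _ hh) i, inferInstance, ?_⟩
  rw [Scheme.Hom.comp_apply]
  exact (congrArg h hz).trans hy

namespace IsShortExact

open VectorSpaceScheme

variable {F : Type v} [Field F] {k : Type u} [Field k]
  {G G' G'' : VectorSpaceScheme F (Spec (CommRingCat.of k))} {f : G' ⟶ G} {g : G ⟶ G''}
  (hfg : IsShortExact f g)
include hfg

/-- The universal point of `G''` lifts to `G` on an fppf cover. An affine flat member of the cover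
whose image contains `P` gives `C`, and the lift over it is `s`. -/
lemma exists_flat_section (P : PrimeSpectrum G''.CoordinateRing) :
    ∃ (C : Type u) (_ : CommRing C) (s : G.CoordinateRing →+* C),
      (s.comp (comorphism g).toRingHom).Flat ∧
        P ∈ Set.range (PrimeSpectrum.comap (s.comp (comorphism g).toRingHom)) := by
  let X := G''.scheme.left
  let x : Spec Γ(X, ⊤) := P
  have := hfg.locallySurjective
  have hmem := Presheaf.imageSieve_mem (Scheme.fppfTopology.over _) g.hom (U := op G''.scheme)
    G''.universalPoint
  rw [GrothendieckTopology.mem_over_iff] at hmem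
  obtain ⟨C, t, z, ht, hflat, hz⟩ :=
    exists_flat_spec_of_mem_fppfTopology hmem (X.isoSpec.inv x)
  rw [Sieve.overEquiv_iff] at ht
  let : Algebra k C := (Spec.preimage (t ≫ G''.scheme.hom)).hom.toAlgebra
  have hC : Spec.map (CommRingCat.ofHom (algebraMap k C)) = t ≫ G''.scheme.hom :=
    Spec.map_preimage _
  let t' : specOver k C ⟶ G''.scheme := Over.homMk t hC.symm
  have ht' : (Presheaf.imageSieve g.hom (U := G''.scheme) G''.universalPoint) t' :=
by
    have h := Sieve.downward_closed _ ht
      (Over.homMk (𝟙 _) (by simp [hC]) : specOver k C ⟶ Over.mk (t ≫ G''.scheme.hom))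
    convert! h
  obtain ⟨y, hy⟩ := ht'
  have hy' : pointsHom g C y = G''.representableBy.homEquiv t' := by
    have h1 := G''.representableBy.homEquiv_comp t' (𝟙 _)
    rw [Category.comp_id] at h1
    exact hy.trans h1.symm
  let φ : Γ(X, ⊤) ⟶ C := t.appTop ≫ (Scheme.ΓSpecIso C).hom
  have hφ : (G.pointsEquiv y).toRingHom.comp (comorphism g).toRingHom = φ.hom := by
    have h := pointsEquiv_pointsHom g y
    rw [hy'] at h
    simp only [pointsEquiv, Equiv.trans_apply, Equiv.symm_apply_apply, Equiv.coe_fn_mk] at h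
    exact congrArg AlgHom.toRingHom h.symm
  have hmap : Spec.map φ = t ≫ X.isoSpec.hom := by
    rw [← Iso.comp_inv_eq]
    exact specMap_appTop_isoSpec_inv t
  refine ⟨C, inferInstance, (G.pointsEquiv y).toRingHom, ?_, ?_⟩
  · rw [hφ]
    refine Flat.SpecMap_iff.mp ?_
    rw [hmap]
    infer_instance
  · rw [hφ]
    refine ⟨z, ?_⟩
    change Spec.map φ z = x
    rw [hmap, Scheme.Hom.comp_apply, hz, ← Scheme.Hom.comp_apply, Iso.inv_hom_id]
    rfl

/-- The base has finitely many primes, so the product of the local covers `C P` is flat, hence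
faithfully flat, and carries a section. Over it a `k`-basis of the coordinate ring of `G'` gives a
basis, and freeness descends. -/
lemma nonempty_basis [Algebra G''.CoordinateRing G.CoordinateRing]
    [IsScalarTower k G''.CoordinateRing G.CoordinateRing]
    (hg : ∀ b, algebraMap G''.CoordinateRing G.CoordinateRing b = comorphism g b) :
    Nonempty (Module.Basis (Fin (Module.finrank k G'.CoordinateRing))
      G''.CoordinateRing G.CoordinateRing) := by
  classical
  have : IsArtinianRing G''.CoordinateRing := IsArtinianRing.of_finite k _
  have := Fintype.ofFinite (PrimeSpectrum G''.CoordinateRing)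
  choose C hC s hs hP using hfg.exists_flat_section
  let _ (P : PrimeSpectrum G''.CoordinateRing) : Algebra G''.CoordinateRing (C P) :=
    ((s P).comp (comorphism g).toRingHom).toAlgebra
  have hflat (P : PrimeSpectrum G''.CoordinateRing) : Module.Flat G''.CoordinateRing (C P) := hs P
  have : Module.Flat G''.CoordinateRing (∀ P, C P) :=
    .of_linearEquiv (DFinsupp.linearEquivFunOnFintype (R := G''.CoordinateRing)).symm
  have : Module.FaithfullyFlat G''.CoordinateRing (∀ P, C P) := by
    refine .of_comap_surjective fun P => ?_
    obtain ⟨Q, hQ⟩ := hP P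
    exact ⟨Q.comap (Pi.evalRingHom C P), hQ⟩
  let : Algebra k (∀ P, C P) := Algebra.compHom _ (algebraMap k G''.CoordinateRing)
  have : IsScalarTower k G''.CoordinateRing (∀ P, C P) := .of_algebraMap_eq fun _ => rfl
  let σ : G.CoordinateRing →ₐ[G''.CoordinateRing] (∀ P, C P) :=
    { RingHom.pi s with commutes' := fun b => by rw [hg]; rfl }
  obtain ⟨e⟩ := hfg.nonempty_algEquiv_of_section hg _ σ
  have : Module.Finite G''.CoordinateRing G.CoordinateRing := .of_restrictScalars_finite k _ _
  refine nonempty_basis_of_faithfullyFlat (C := ∀ P, C P) ?_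
  exact ((Module.finBasis k G'.CoordinateRing).baseChange _).map e.symm.toLinearEquiv

end IsShortExact

/-! ### Arithmetic of `Fˣ` in `k`, and the final assembly. -/

section FiniteField

variable (F : Type*) [Field F] (k : Type*) [Field k] [Algebra F k]

/-- In `k` the order of `Fˣ` is `|F| - 1 = -1`. -/
lemma card_units_cast_ne_zero [Fintype F] [Fintype Fˣ] : (Fintype.card Fˣ : k) ≠ 0 := by
  classical
  have h : (Fintype.card F : k) = 0 := by
    rw [← map_natCast (algebraMap F k), FiniteField.cast_card_eq_zero, map_zero]
  have h2 : Fintype.card F = Fintype.card Fˣ + 1 := by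
    convert! Fintype.card_eq_card_units_add_one F
  rw [h2, Nat.cast_add, Nat.cast_one] at h
  rw [eq_neg_of_add_eq_zero_left h]
  exact neg_ne_zero.mpr one_ne_zero

/-- A generator of the cyclic group `Fˣ` maps to a primitive root of unity in `k`. -/
lemma hasEnoughRootsOfUnity_exponent_units [Finite F] :
    HasEnoughRootsOfUnity k (Monoid.exponent Fˣ) := by
  obtain ⟨ζ, hζ⟩ := IsCyclic.exists_ofOrder_eq_natCard (α := Fˣ)
  have hprim : IsPrimitiveRoot ζ (Monoid.exponent Fˣ) := by
    rw [IsCyclic.exponent_eq_card, ← hζ]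
    exact IsPrimitiveRoot.orderOf ζ
  have : NeZero (Monoid.exponent Fˣ) := ⟨Monoid.exponent_ne_zero_of_finite⟩
  refine ⟨⟨algebraMap F k ζ, ?_⟩, inferInstance⟩
  exact (IsPrimitiveRoot.coe_units_iff.mpr hprim).map_of_injective (algebraMap F k).injective

end FiniteField

/-- The product in the group semiring is given by convolution. -/
lemma sum_single_mul_sum_single {X : Type*} [CommGroup X] [Fintype X] (m n : X → ℕ) :
    (∑ x, MonoidAlgebra.single x (m x)) * ∑ x, MonoidAlgebra.single x (n x) =
      ∑ x, MonoidAlgebra.single x (∑ y, m y * n (x / y)) := by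
  have hsum (x : X) (r : X → ℕ) :
      MonoidAlgebra.single x (∑ y, r y) = ∑ y, MonoidAlgebra.single x (r y) :=
    map_sum (MonoidAlgebra.singleAddHom x) _ _
  simp only [hsum, Finset.sum_mul_sum, MonoidAlgebra.single_mul_single]
  rw [Finset.sum_comm (γ := X) (α := X) (f := fun x y => MonoidAlgebra.single x (m y * n (x / y)))]
  refine Finset.sum_congr rfl fun y _ => Fintype.sum_equiv (Equiv.mulLeft y) _ _ fun x => ?_
  rw [Equiv.coe_mulLeft, mul_div_cancel_left]

namespace IsShortExact

open VectorSpaceScheme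

variable {F : Type v} [Field F] [Finite F] {k : Type u} [Field k] [Algebra F k]
  {G G' G'' : VectorSpaceScheme F (Spec (CommRingCat.of k))} {f : G' ⟶ G} {g : G ⟶ G''}

lemma finrank_isotypicComponent (hfg : IsShortExact f g) [Fintype (Fˣ →* kˣ)] (χ : Fˣ →* kˣ) :
    Module.finrank k (G.isotypicComponent χ) = ∑ ψ : Fˣ →* kˣ,
      Module.finrank k (G'.isotypicComponent ψ) *
        Module.finrank k (G''.isotypicComponent (χ / ψ)) := by
  have := Fintype.ofFinite F
  have := Fintype.ofFinite Fˣ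
  have := hasEnoughRootsOfUnity_exponent_units F k
  let : Algebra G''.CoordinateRing G.CoordinateRing := (comorphism g).toRingHom.toAlgebra
  have : IsScalarTower k G''.CoordinateRing G.CoordinateRing :=
    .of_algebraMap_eq fun r => ((comorphism g).commutes r).symm
  obtain ⟨b⟩ := hfg.nonempty_basis fun _ => rfl
  simp only [isotypicComponent_eq]
  refine finrank_isotypic_eq_sum (card_units_cast_ne_zero F k) (ρ := G''.coactionHom)
    (fun h b a => ?_) (comorphism f).toLinearMap (fun h => comorphism_coaction f h)
    hfg.comorphism_surjective (I := RingHom.ker G''.counit) (fun a ha => ?_) b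
    (fun h b hb => (counit_coaction _ b).trans hb)
    (fun h hh => ker_counit_le_displacementIdeal hh) χ
  · have h1 : G.coaction h (comorphism g b * a) =
        comorphism g (G''.coaction h b) * G.coaction h a := by rw [map_mul, comorphism_coaction]
    exact h1
  · rw [Ideal.smul_top_eq_map]
    exact hfg.mem_of_comorphism_eq_zero ha

end IsShortExact

end VectorSpaceSchemes

end

theorem mainTheorem3 {F : Type v} [Field F] [Finite F] {k : Type u} [Field k] [PerfectField k]
    [Algebra F k]
    {G' G G'' : VectorSpaceSchemes.VectorSpaceScheme F (Spec (CommRingCat.of k))}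
    (f : G' ⟶ G) (g : G ⟶ G'') (hfg : VectorSpaceSchemes.IsShortExact f g) :
    VectorSpaceSchemes.VectorSpaceScheme.character G =
      VectorSpaceSchemes.VectorSpaceScheme.character G' *
        VectorSpaceSchemes.VectorSpaceScheme.character G'' := by
  have := Fintype.ofFinite (Fˣ →* kˣ)
  -- The definition of `character` fixes its own `Fintype` instance on the characters; this passes
  -- to the one in context.
  have hchar (E : VectorSpaceSchemes.VectorSpaceScheme F (Spec (CommRingCat.of k))) :
      E.character = ∑ χ : Fˣ →* kˣ,
        MonoidAlgebra.single χ (Module.finrank k (E.isotypicComponent χ)) := by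
    rw [VectorSpaceSchemes.VectorSpaceScheme.character]
    congr!
  rw [hchar, hchar, hchar]
  have hconv := VectorSpaceSchemes.sum_single_mul_sum_single (X := Fˣ →* kˣ)
    (fun χ => Module.finrank k (G'.isotypicComponent χ))
    (fun χ => Module.finrank k (G''.isotypicComponent χ))
  refine Eq.trans ?_ hconv.symm
  exact Finset.sum_congr rfl fun χ _ => by rw [hfg.finrank_isotypicComponent]
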